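/- Let $K$ be a totally real cubic number field with set of complex embeddings $\Sigma$ (all of them real), and let $\mathcal O\subset K$ be an order, i.e. a subring that is finitely generated as an abelian group and spans $K$ over $\mathbf Q$. The image of the unit group $\mathcal O^\times$ under $\alpha\mapsto(\log|\sigma(\alpha)|)_{\sigma\in\Sigma}$ is a lattice in the trace-zero plane $H=\{x\in\mathbf R^{\Sigma}:\sum_\sigma x_\sigma=0\}$. Identify $H$ isometrically with $\mathbf R^2$ and rescale this lattice to covolume one, writing it as $\mathbf Z^2g$ (the lattice spanned by the rows of $g$) with $g\in SL_2(\mathbf R)$. The shape of $\mathcal O^\times$ is the class of $g\cdot i$ in the modular surface $SL_2(\mathbf Z)\backslash\mathbf H=SL_2(\mathbf Z)\backslash SL_2(\mathbf R)/SO_2(\mathbf R)$; it depends on the choice of the isometry $H\cong\mathbf R^2$ at most through its orientation, whose reversal replaces the shape by its mirror image. Theorem. However these isometries are chosen, the set of shapes of the unit groups of all orders of totally real cubic number fields is unbounded in the modular surface: its closure in $SL_2(\mathbf Z)\backslash\mathbf H$ is not compact, and it contains points at arbitrarily large distance from any given point, for the distance induced by the hyperbolic distance of $\mathbf H$. -/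

import Mathlib

open scoped MatrixGroups UpperHalfPlane Pointwise
open NumberField

noncomputable section

/-- An order of a number field `K`: a subring which is finitely generated as an additive group
and spans `K` over `ℚ`. -/
structure IsOrder {K : Type*} [Field K] [NumberField K] (O : Subring K) : Prop where
  finite : Module.Finite ℤ O
  span_eq_top : Submodule.span ℚ (O : Set K) = ⊤

/-- An order `O` of a totally real cubic number field `K`. -/
structure TotallyRealCubicOrder where
  K : Type
  [field : Field K]
  [numberField : NumberField K]
  [totallyReal : IsTotallyReal K]
  finrank_eq : Module.finrank ℚ K = 3
  O : Subring K
  isOrder : IsOrder O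

attribute [instance] TotallyRealCubicOrder.field TotallyRealCubicOrder.numberField
  TotallyRealCubicOrder.totallyReal

/-- The trace-zero hyperplane in `ℝ^Σ`, where `Σ` is the set of complex embeddings of `K`,
with the Euclidean metric. -/
def traceZero (K : Type*) [Field K] [NumberField K] :
    Submodule ℝ (EuclideanSpace ℝ (K →+* ℂ)) where
  carrier := {x | ∑ σ, x σ = 0}
  add_mem' {x y} hx hy := by
    simp only [Set.mem_ofPred_eq, PiLp.add_apply, Finset.sum_add_distrib] at *
    simp [hx, hy]
  zero_mem' := by simp
  smul_mem' c x hx := by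
    simp only [Set.mem_ofPred_eq, PiLp.smul_apply, smul_eq_mul, ← Finset.mul_sum] at *
    simp [hx]

/-- The logarithmic embedding `α ↦ (log |σ α|)_σ` of the multiplicative group of `K`. -/
def logEmbedding (K : Type*) [Field K] [NumberField K] (α : Kˣ) :
    EuclideanSpace ℝ (K →+* ℂ) :=
  WithLp.toLp 2 fun σ => Real.log ‖σ (α : K)‖

/-- The logarithmic embedding is a homomorphism. -/
theorem logEmbedding_mul (K : Type*) [Field K] [NumberField K] (α β : Kˣ) :
    logEmbedding K (α * β) = logEmbedding K α + logEmbedding K β := by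
  ext σ
  simp only [logEmbedding, PiLp.add_apply, Units.val_mul, map_mul, norm_mul]
  exact Real.log_mul (by simp) (by simp)

/-- Units of an order have logarithmic image of trace zero, since their norm is `±1`. -/
theorem logEmbedding_mem_traceZero {K : Type*} [Field K] [NumberField K] {O : Subring K}
    (hO : IsOrder O) (u : Oˣ) :
    logEmbedding K (Units.map (O.subtype : O →* K) u) ∈ traceZero K := by
  have := hO.finite
  have hint : ∀ v : O, IsIntegral ℤ (v : K) := fun v =>
    (Algebra.IsIntegral.isIntegral (R := ℤ) v).map (O.subtype.toIntAlgHom)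
  have key : ∀ v : O, ∃ n : ℤ, Algebra.norm ℚ (v : K) = n := fun v => by
    obtain ⟨n, hn⟩ := IsIntegrallyClosed.isIntegral_iff.mp (Algebra.isIntegral_norm ℚ (hint v))
    exact ⟨n, by simpa using hn.symm⟩
  obtain ⟨m, hm⟩ := key u
  obtain ⟨n, hn⟩ := key (u⁻¹ : Oˣ)
  have hmul : (m : ℚ) * n = 1 := by
    rw [← hm, ← hn, ← map_mul, ← Subring.coe_mul]
    simp
  have hmul' : m * n = 1 := by exact_mod_cast hmul
  have habs : |m| = 1 := Int.isUnit_iff_abs_eq.mp (IsUnit.of_mul_eq_one n hmul')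
  have hprod : ∏ σ : K →+* ℂ, ‖σ ((u : O) : K)‖ = 1 := by
    have h := Algebra.norm_eq_prod_embeddings ℚ ℂ ((u : O) : K)
    rw [hm] at h
    have h2 := congrArg norm h
    rw [norm_prod, ← Equiv.prod_comp (RingHom.equivRatAlgHom (R := K) (S := ℂ))] at h2
    simp only [RingHom.equivRatAlgHom_apply, RingHom.toRatAlgHom_apply] at h2
    rw [← h2]
    simp only [map_intCast, Complex.norm_intCast]
    exact_mod_cast habs
  change ∑ σ : K →+* ℂ, Real.log ‖σ ((u : O) : K)‖ = 0
  rw [← Real.log_prod (fun σ _ => by simp), hprod, Real.log_one]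

/-- The unit lattice of an order: the image of its unit group under the logarithmic embedding,
as a subgroup of the trace-zero hyperplane. -/
def unitLattice {K : Type*} [Field K] [NumberField K] {O : Subring K} (hO : IsOrder O) :
    AddSubgroup (traceZero K) :=
  (AddMonoidHom.mk' (fun u : Additive Oˣ =>
    (⟨logEmbedding K (Units.map (O.subtype : O →* K) u.toMul),
      logEmbedding_mem_traceZero hO u.toMul⟩ : traceZero K))
    (fun u v => Subtype.ext (by
      simp only [toMul_add, map_mul, logEmbedding_mul, Submodule.coe_add]))).range

/-- The modular surface `SL₂(ℤ) \ ℍ`, with the quotient topology. -/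
abbrev ModularSurface : Type := MulAction.orbitRel.Quotient SL(2, ℤ) ℍ

/-- The class in the modular surface of a point of the upper half-plane. -/
def ModularSurface.mk (z : ℍ) : ModularSurface := Quotient.mk _ z

/-- The unimodular lattice `ℤ² g` in `ℝ²` generated by the rows of `g ∈ SL₂(ℝ)`. -/
def rowLattice (g : SL(2, ℝ)) : AddSubgroup (EuclideanSpace ℝ (Fin 2)) :=
  AddSubgroup.closure (Set.range fun i : Fin 2 => WithLp.toLp 2 (g.1 i))

/-- `x` is the point of the modular surface attached to the lattice `L` in `ℝ²`: after rescaling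
to covolume one, `L` is `ℤ² g` for some `g ∈ SL₂(ℝ)`, and `x` is the class of `g • i`
under the identification `SL₂(ℤ) \ SL₂(ℝ) / SO₂(ℝ) = SL₂(ℤ) \ ℍ`. -/
def IsLatticeShape (L : AddSubgroup (EuclideanSpace ℝ (Fin 2))) (x : ModularSurface) : Prop :=
  ∃ (c : ℝ) (g : SL(2, ℝ)), 0 < c ∧
    c • (L : Set (EuclideanSpace ℝ (Fin 2))) = rowLattice g ∧
    x = ModularSurface.mk (g • UpperHalfPlane.I)

/-- An isometric identification of the trace-zero hyperplane with `ℝ²`, for every order of a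
totally real cubic field. -/
abbrev PlaneIdentification : Type 1 :=
  ∀ 𝒪 : TotallyRealCubicOrder, traceZero 𝒪.K ≃ₗᵢ[ℝ] EuclideanSpace ℝ (Fin 2)

/-- The set of shapes of the unit groups of all orders of totally real cubic fields, computed
with the isometric identifications `e`. -/
def shapeSet (e : PlaneIdentification) : Set ModularSurface :=
  {x | ∃ 𝒪 : TotallyRealCubicOrder,
    IsLatticeShape ((unitLattice 𝒪.isOrder).map (e 𝒪).toLinearEquiv.toLinearMap.toAddMonoidHom) x}

end

/-!
For `t ≥ 2` put `N = 4t³ - 1`, `u = -2t`, `v = N - 2t`, `w = t`, and let `K = ℚ(θ)` where `θ` is a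
root of `(X + u) (X + v) (X + w) - 1`. This cubic has three real roots, close to `-u`, `-v`, `-w`,
and `A = θ + u`, `B = θ + v`, `C = θ + w` are units of `ℤ[θ]` with `A B C = 1`. The parameters are
chosen so that modulo `N` the cubic has the double root `0` and `u ≡ v`. Hence
`g(θ) ↦ g'(0) mod N` is a well-defined derivation of `ℤ[θ]` along `g(θ) ↦ g(0) mod N`; its kernel
is an order `O`, and the units of `O` are killed by the logarithmic derivative
`χ(g(θ)) = g'(0) / g(0)`, a character of the units of `ℤ[θ]` with values in `ℤ/N`
(`exists_logDeriv`).

The character `χ` is onto, because `χ(C) = 1 / w`. So the unit lattice of `O` has covolume at least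
`N` times that of `ℤ[θ]` (`le_area_of_character`), and the latter is bounded below by an absolute
constant: a unit `x ≠ ±1` of a totally real order has some `|log |σ x|| ≥ 1/4`, as otherwise
`x² - 1` would have norm less than one in absolute value
(`eq_one_or_eq_neg_one_of_abs_log_lt`). On the other hand `O` contains the unit `A / B = A² C`, as
`u ≡ v`, whose logarithmic vector has length `O(log t)`. After rescaling to covolume one, the unit
lattice of `O` contains a vector of squared length `O(log² t / N)`, so its shape has a
representative of height at least a constant times `N / log² t`
(`exists_area_div_le_im`, `exists_mem_shapeSet_le_im`). This tends to infinity with `t`, and points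
high in the cusp are far from any given orbit of the modular group.
-/

/-! ### Lattices in the plane and the modular surface -/

/-- The oriented area of the parallelogram spanned by two vectors of the plane. -/
def area (x y : EuclideanSpace ℝ (Fin 2)) : ℝ := x 0 * y 1 - x 1 * y 0

theorem area_swap (x y : EuclideanSpace ℝ (Fin 2)) : area y x = -area x y := by
  unfold area; ring

theorem area_combination (x y : EuclideanSpace ℝ (Fin 2)) (m n p q : ℤ) :
    area (m • x + n • y) (p • x + q • y) = ((m * q - n * p : ℤ) : ℝ) * area x y := by
  simp [area]; ring

theorem area_ne_zero_of_linearIndependent {x y : EuclideanSpace ℝ (Fin 2)}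
    (h : LinearIndependent ℝ ![x, y]) : area x y ≠ 0 := by
  intro h0
  rw [LinearIndependent.pair_iff] at h
  unfold area at h0
  have h1 := h (y 0) (-x 0) (by ext i; fin_cases i <;> simp <;> linarith)
  have h2 := h (y 1) (-x 1) (by ext i; fin_cases i <;> simp <;> linarith)
  have h3 := h 1 0 (by ext i; fin_cases i <;> simp <;> linarith)
  exact one_ne_zero h3.1

/-- A subgroup of the plane whose nonzero vectors are bounded away from zero and which contains
two linearly independent vectors has a positively oriented `ℤ`-basis. -/
theorem exists_oriented_basis {L : AddSubgroup (EuclideanSpace ℝ (Fin 2))} {c : ℝ} (hc : 0 < c)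
    (hmin : ∀ x ∈ L, x ≠ 0 → c ≤ ‖x‖) {x y : EuclideanSpace ℝ (Fin 2)} (hx : x ∈ L) (hy : y ∈ L)
    (hxy : LinearIndependent ℝ ![x, y]) :
    ∃ b₁ b₂, 0 < area b₁ b₂ ∧ L = AddSubgroup.closure {b₁, b₂} := by
  set M : Submodule ℤ (EuclideanSpace ℝ (Fin 2)) := AddSubgroup.toIntSubmodule L with hM
  have : DiscreteTopology M :=
    DiscreteTopology.of_forall_le_norm hc fun v hv =>
      hmin v v.2 fun h => hv (Subtype.ext h)
  have : IsZLattice ℝ M := ⟨by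
    have h2 := hxy.span_eq_top_of_card_eq_finrank (by simp)
    rw [eq_top_iff, ← h2]
    apply Submodule.span_mono
    rintro _ ⟨i, rfl⟩
    fin_cases i
    · exact hx
    · exact hy⟩
  have := ZLattice.module_free ℝ M
  have := ZLattice.module_finite ℝ M
  have hrank : Module.finrank ℤ M = 2 := by rw [ZLattice.rank ℝ M]; simp
  set b := Module.finBasisOfFinrankEq ℤ M hrank
  have hli : LinearIndependent ℝ ![(b 0 : EuclideanSpace ℝ (Fin 2)), (b 1 : _)] := by
    have hb : ![(b 0 : EuclideanSpace ℝ (Fin 2)), (b 1 : _)] = b.ofZLatticeBasis ℝ M := by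
      ext i
      fin_cases i <;> simp
    rw [hb]
    exact (b.ofZLatticeBasis ℝ M).linearIndependent
  have hcl : L = AddSubgroup.closure
      {(b 0 : EuclideanSpace ℝ (Fin 2)), (b 1 : EuclideanSpace ℝ (Fin 2))} := by
    have := b.ofZLatticeBasis_span ℝ M
    apply AddSubgroup.ext
    intro z
    change z ∈ M ↔ _
    have hr : Set.range (b.ofZLatticeBasis ℝ M) =
        {(b 0 : EuclideanSpace ℝ (Fin 2)), (b 1 : EuclideanSpace ℝ (Fin 2))} := by
      ext w; simp [Fin.exists_fin_two, eq_comm]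
    rw [AddSubgroup.mem_closure_pair, ← Submodule.mem_span_pair, ← hr, this]
  rcases (area_ne_zero_of_linearIndependent hli).lt_or_gt with h | h
  · exact ⟨b 1, b 0, by rw [area_swap]; linarith, by rw [Set.pair_comm]; exact hcl⟩
  · exact ⟨b 0, b 1, h, hcl⟩

theorem im_smul_I (h : SL(2, ℝ)) :
    (h • UpperHalfPlane.I).im = 1 / (h.1 1 0 ^ 2 + h.1 1 1 ^ 2) := by
  have := UpperHalfPlane.im_smul_eq_div_normSq (h : GL (Fin 2) ℝ) UpperHalfPlane.I
  rw [show h • UpperHalfPlane.I = (h : GL (Fin 2) ℝ) • UpperHalfPlane.I from rfl, this]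
  simp [UpperHalfPlane.denom, Complex.normSq_apply]
  ring

/-- The bottom row of `γ g` is the combination of the rows of `g` given by the bottom row
of `γ`. -/
theorem im_smul_smul_I (γ : SL(2, ℤ)) (g : SL(2, ℝ)) :
    (γ • g • UpperHalfPlane.I).im =
      1 / ((γ.1 1 0 * g.1 0 0 + γ.1 1 1 * g.1 1 0) ^ 2 +
        (γ.1 1 0 * g.1 0 1 + γ.1 1 1 * g.1 1 1) ^ 2) := by
  have : γ • g • UpperHalfPlane.I = ((γ.map (Int.castRingHom ℝ)) * g) • UpperHalfPlane.I := by
    rw [mul_smul]; rfl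
  rw [this, im_smul_I]
  simp [Matrix.mul_apply, Fin.sum_univ_two]

/-- The matrix in `SL₂(ℝ)` whose rows are two vectors, rescaled to span a parallelogram of
area one. -/
noncomputable def unimodularMatrix (b₁ b₂ : EuclideanSpace ℝ (Fin 2)) (h : 0 < area b₁ b₂) :
    SL(2, ℝ) :=
  ⟨!![b₁ 0 / √(area b₁ b₂), b₁ 1 / √(area b₁ b₂);
      b₂ 0 / √(area b₁ b₂), b₂ 1 / √(area b₁ b₂)], by
    have h1 := Real.mul_self_sqrt h.le
    have h2 : √(area b₁ b₂) ≠ 0 := (Real.sqrt_pos.2 h).ne'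
    rw [Matrix.det_fin_two_of]
    field_simp
    rw [sq, h1, area]⟩

theorem isLatticeShape_unimodularMatrix {b₁ b₂ : EuclideanSpace ℝ (Fin 2)}
    (h : 0 < area b₁ b₂) :
    IsLatticeShape (AddSubgroup.closure {b₁, b₂})
      (ModularSurface.mk (unimodularMatrix b₁ b₂ h • UpperHalfPlane.I)) := by
  have h2 := Real.sqrt_pos.2 h
  refine ⟨(√(area b₁ b₂))⁻¹, unimodularMatrix b₁ b₂ h, inv_pos.2 h2, ?_, rfl⟩
  have hr : (Set.range fun i : Fin 2 => WithLp.toLp 2 ((unimodularMatrix b₁ b₂ h).1 i)) =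
      {(√(area b₁ b₂))⁻¹ • b₁, (√(area b₁ b₂))⁻¹ • b₂} := by
    have e0 : WithLp.toLp 2 ((unimodularMatrix b₁ b₂ h).1 0) = (√(area b₁ b₂))⁻¹ • b₁ := by
      ext i; fin_cases i <;> simp [unimodularMatrix, div_eq_inv_mul]
    have e1 : WithLp.toLp 2 ((unimodularMatrix b₁ b₂ h).1 1) = (√(area b₁ b₂))⁻¹ • b₂ := by
      ext i; fin_cases i <;> simp [unimodularMatrix, div_eq_inv_mul]
    rw [← e0, ← e1]
    ext w; simp [Fin.exists_fin_two, eq_comm]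
  unfold rowLattice
  rw [hr]
  ext w
  simp only [Set.mem_smul_set, SetLike.mem_coe, AddSubgroup.mem_closure_pair]
  constructor
  · rintro ⟨_, ⟨m, n, rfl⟩, rfl⟩
    exact ⟨m, n, by rw [smul_add, smul_comm _ m, smul_comm _ n]⟩
  · rintro ⟨m, n, rfl⟩
    exact ⟨_, ⟨m, n, rfl⟩, by rw [smul_add, smul_comm _ m, smul_comm _ n]⟩

theorem im_smul_unimodularMatrix {b₁ b₂ : EuclideanSpace ℝ (Fin 2)} (h : 0 < area b₁ b₂)
    (γ : SL(2, ℤ)) :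
    (γ • unimodularMatrix b₁ b₂ h • UpperHalfPlane.I).im =
      area b₁ b₂ / ‖γ.1 1 0 • b₁ + γ.1 1 1 • b₂‖ ^ 2 := by
  have h1 := Real.sq_sqrt h.le
  have h2 : √(area b₁ b₂) ≠ 0 := (Real.sqrt_pos.2 h).ne'
  rw [im_smul_smul_I, EuclideanSpace.norm_sq_eq, Fin.sum_univ_two]
  simp only [unimodularMatrix, Matrix.of_apply, Matrix.cons_val', Matrix.cons_val_zero,
    Matrix.cons_val_one, Matrix.cons_val_fin_one, PiLp.add_apply, PiLp.smul_apply,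
    zsmul_eq_mul, Real.norm_eq_abs, sq_abs]
  rw [← mul_div_assoc, ← mul_div_assoc, ← mul_div_assoc, ← mul_div_assoc, ← add_div, ← add_div,
    div_pow, div_pow, ← add_div, one_div_div, h1]

/-- Every lattice with basis `b₁, b₂` contains a nonzero vector whose squared length is at most
twice the covolume. This is read off from a representative in the standard fundamental domain of
the modular group. -/
theorem exists_short_vector {b₁ b₂ : EuclideanSpace ℝ (Fin 2)} (h : 0 < area b₁ b₂) :
    ∃ x ∈ AddSubgroup.closure {b₁, b₂}, x ≠ 0 ∧ ‖x‖ ^ 2 ≤ 2 * area b₁ b₂ := by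
  obtain ⟨γ, hγ⟩ := ModularGroup.exists_smul_mem_fd (unimodularMatrix b₁ b₂ h • UpperHalfPlane.I)
  have him := ModularGroup.three_le_four_mul_im_sq_of_mem_fd hγ
  have hpos := (γ • unimodularMatrix b₁ b₂ h • UpperHalfPlane.I).im_pos
  have hhalf : 1 / 2 ≤ (γ • unimodularMatrix b₁ b₂ h • UpperHalfPlane.I).im := by nlinarith
  refine ⟨γ.1 1 0 • b₁ + γ.1 1 1 • b₂, AddSubgroup.mem_closure_pair.2 ⟨_, _, rfl⟩, ?_, ?_⟩
  · intro h0
    rw [im_smul_unimodularMatrix, h0] at hpos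
    simp at hpos
  · rw [im_smul_unimodularMatrix] at hhalf hpos
    have hn : 0 < ‖γ.1 1 0 • b₁ + γ.1 1 1 • b₂‖ ^ 2 := by
      by_contra hcon
      have : ‖γ.1 1 0 • b₁ + γ.1 1 1 • b₂‖ ^ 2 = 0 := le_antisymm (not_lt.1 hcon) (sq_nonneg _)
      rw [this] at hpos
      simp at hpos
    rw [le_div_iff₀ hn] at hhalf
    linarith

/-- A short vector in a lattice pushes its shape into the cusp: after division by its content it
becomes primitive, hence the bottom row of some `γ g`. -/
theorem exists_area_div_le_im {b₁ b₂ : EuclideanSpace ℝ (Fin 2)} (h : 0 < area b₁ b₂)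
    {x : EuclideanSpace ℝ (Fin 2)} (hx : x ∈ AddSubgroup.closure {b₁, b₂}) (hx0 : x ≠ 0) :
    ∃ γ : SL(2, ℤ), area b₁ b₂ / ‖x‖ ^ 2 ≤
      (γ • unimodularMatrix b₁ b₂ h • UpperHalfPlane.I).im := by
  obtain ⟨m, n, rfl⟩ := AddSubgroup.mem_closure_pair.1 hx
  have hmn : 0 < Int.gcd m n := by
    apply Nat.pos_of_ne_zero
    rw [Ne, Int.gcd_eq_zero_iff]
    rintro ⟨rfl, rfl⟩
    simp at hx0
  obtain ⟨m', n', hco, hm, hn⟩ := Int.exists_gcd_one hmn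
  obtain ⟨γ, h0, h1⟩ := (Int.isCoprime_iff_gcd_eq_one.2 hco).exists_SL2_row 1
  refine ⟨γ, ?_⟩
  rw [im_smul_unimodularMatrix]
  have hk : m • b₁ + n • b₂ = (Int.gcd m n : ℝ) • (γ.1 1 0 • b₁ + γ.1 1 1 • b₂) := by
    rw [h0, h1]
    generalize Int.gcd m n = k at hm hn
    subst hm hn
    ext i
    simp
    ring
  have hne : γ.1 1 0 • b₁ + γ.1 1 1 • b₂ ≠ 0 := by
    intro h3; rw [h3, smul_zero] at hk; exact hx0 hk
  have hpos : 0 < ‖γ.1 1 0 • b₁ + γ.1 1 1 • b₂‖ := norm_pos_iff.2 hne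
  gcongr
  rw [hk, norm_smul, Real.norm_natCast]
  exact le_mul_of_one_le_left hpos.le (by exact_mod_cast hmn)

/-- Let `ℓ : G → ℝ²` be a homomorphism whose image is a discrete lattice with minimal length at
least `c`, and let `χ : G → ℤ/N` be a surjective character that factors through `ℓ`. A lattice
in `ℓ (ker χ)` has covolume at least `N c² / 2`: the matrix expressing its basis in a basis of
`ℓ(G)` annihilates `χ`, so its determinant is divisible by `N` by Cramer's rule. -/
theorem le_area_of_character {G : Type*} [AddCommGroup G]
    (ℓ : G →+ EuclideanSpace ℝ (Fin 2)) {N : ℕ} (χ : G →+ ZMod N)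
    (hker : ∀ g, ℓ g = 0 → χ g = 0) (hχ : ∃ g, IsUnit (χ g)) {c : ℝ} (hc : 0 < c)
    (hmin : ∀ g, ℓ g ≠ 0 → c ≤ ‖ℓ g‖) {v₁ v₂ : EuclideanSpace ℝ (Fin 2)}
    (hv₁ : ∃ g, χ g = 0 ∧ ℓ g = v₁) (hv₂ : ∃ g, χ g = 0 ∧ ℓ g = v₂) (hv : 0 < area v₁ v₂) :
    N * (c ^ 2 / 2) ≤ area v₁ v₂ := by
  obtain ⟨g₁, hg₁, rfl⟩ := hv₁
  obtain ⟨g₂, hg₂, rfl⟩ := hv₂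
  have hli : LinearIndependent ℝ ![ℓ g₁, ℓ g₂] := by
    rw [LinearIndependent.pair_iff]
    intro s t hst
    have e0 := congrArg (fun v : EuclideanSpace ℝ (Fin 2) => v 0) hst
    have e1 := congrArg (fun v : EuclideanSpace ℝ (Fin 2) => v 1) hst
    simp only [PiLp.add_apply, PiLp.smul_apply, smul_eq_mul, PiLp.zero_apply] at e0 e1
    have hv' := hv.ne'
    unfold area at hv'
    constructor
    · refine (mul_eq_zero.1 (?_ : s * (ℓ g₁ 0 * ℓ g₂ 1 - ℓ g₁ 1 * ℓ g₂ 0) = 0)).resolve_right hv'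
      linear_combination ℓ g₂ 1 * e0 - ℓ g₂ 0 * e1
    · refine (mul_eq_zero.1 (?_ : t * (ℓ g₁ 0 * ℓ g₂ 1 - ℓ g₁ 1 * ℓ g₂ 0) = 0)).resolve_right hv'
      linear_combination ℓ g₁ 0 * e1 - ℓ g₁ 1 * e0
  obtain ⟨b₁, b₂, hb, hcl⟩ := exists_oriented_basis (L := ℓ.range) hc
    (by rintro _ ⟨g, rfl⟩ h; exact hmin g h) ⟨g₁, rfl⟩ ⟨g₂, rfl⟩ hli
  have hmem : ∀ x, x ∈ ℓ.range ↔ ∃ m n : ℤ, m • b₁ + n • b₂ = x := fun x => by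
    rw [hcl, AddSubgroup.mem_closure_pair]
  obtain ⟨β₁, hβ₁⟩ := (hmem b₁).2 ⟨1, 0, by simp⟩
  obtain ⟨β₂, hβ₂⟩ := (hmem b₂).2 ⟨0, 1, by simp⟩
  have hχlin : ∀ (g : G) (m n : ℤ), m • b₁ + n • b₂ = ℓ g → χ g = m * χ β₁ + n * χ β₂ := by
    intro g m n h
    have := hker (g - (m • β₁ + n • β₂)) (by
      rw [map_sub, map_add, map_zsmul, map_zsmul, hβ₁, hβ₂, h, sub_self])
    rw [map_sub, map_add, map_zsmul, map_zsmul, sub_eq_zero] at this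
    rw [this]
    simp
  obtain ⟨m₁, n₁, h₁⟩ := (hmem _).1 ⟨g₁, rfl⟩
  obtain ⟨m₂, n₂, h₂⟩ := (hmem _).1 ⟨g₂, rfl⟩
  obtain ⟨η, hη⟩ := hχ
  obtain ⟨p, q, hpq⟩ := (hmem _).1 ⟨η, rfl⟩
  have e₁ := hχlin _ _ _ h₁
  have e₂ := hχlin _ _ _ h₂
  have e₃ := hχlin _ _ _ hpq
  rw [hg₁] at e₁
  rw [hg₂] at e₂
  have hdvd : (N : ℤ) ∣ m₁ * n₂ - n₁ * m₂ := by
    rw [← CharP.intCast_eq_zero_iff (ZMod N) N]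
    rw [← hη.mul_left_eq_zero, e₃]
    push_cast
    linear_combination (q * m₂ - p * n₂) * e₁ + (p * n₁ - q * m₁) * e₂
  have harea : area (ℓ g₁) (ℓ g₂) = ((m₁ * n₂ - n₁ * m₂ : ℤ) : ℝ) * area b₁ b₂ := by
    rw [← h₁, ← h₂, area_combination]
  have hdet : 0 < m₁ * n₂ - n₁ * m₂ := by
    rw [harea] at hv
    exact_mod_cast (pos_iff_pos_of_mul_pos hv).2 hb
  have hN : (N : ℝ) ≤ ((m₁ * n₂ - n₁ * m₂ : ℤ) : ℝ) := by
    exact_mod_cast Int.le_of_dvd hdet hdvd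
  obtain ⟨x, hx, hx0, hxb⟩ := exists_short_vector hb
  rw [← hcl] at hx
  obtain ⟨g, rfl⟩ := hx
  have hlen := hmin g hx0
  have hb' : c ^ 2 / 2 ≤ area b₁ b₂ := by nlinarith
  rw [harea]
  gcongr

theorem ModularSurface.mk_smul (γ : SL(2, ℤ)) (z : ℍ) :
    ModularSurface.mk (γ • z) = ModularSurface.mk z :=
  Quotient.sound ⟨γ, rfl⟩

/-- In an orbit of the modular group at most one height exceeds one: every height is either
`Im z` or at most `1 / Im z`. -/
theorem im_smul_eq_or_le (γ : SL(2, ℤ)) (z : ℍ) :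
    (γ • z).im = z.im ∨ (γ • z).im ≤ 1 / z.im := by
  have := UpperHalfPlane.im_smul_eq_div_normSq
    ((γ.map (Int.castRingHom ℝ) : SL(2, ℝ)) : GL (Fin 2) ℝ) z
  have h : (γ • z).im = z.im / ((γ.1 1 0 * z.re + γ.1 1 1) ^ 2 + (γ.1 1 0 * z.im) ^ 2) := by
    rw [show γ • z = ((γ.map (Int.castRingHom ℝ) : SL(2, ℝ)) : GL (Fin 2) ℝ) • z from rfl, this]
    simp [UpperHalfPlane.denom, Complex.normSq_apply]
    ring
  have hz := z.im_pos
  by_cases hc : γ.1 1 0 = 0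
  · left
    have hdet := γ.2
    rw [Matrix.det_fin_two, hc, mul_zero, sub_zero] at hdet
    have h1 : γ.1 1 1 ^ 2 = 1 := by
      rcases Int.isUnit_iff.1 (IsUnit.of_mul_eq_one_right _ hdet) with h | h <;> rw [h] <;> norm_num
    have h1' : (γ.1 1 1 : ℝ) ^ 2 = 1 := by exact_mod_cast h1
    rw [h, hc]
    simp [h1']
  · right
    have h1 : (1 : ℝ) ≤ (γ.1 1 0 : ℝ) ^ 2 := by
      exact_mod_cast Int.one_le_abs (pow_ne_zero 2 hc) |>.trans_eq (abs_of_nonneg (sq_nonneg _))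
    rw [h, div_le_div_iff₀ (by positivity) hz]
    nlinarith [sq_nonneg ((γ.1 1 0 : ℝ) * z.re + γ.1 1 1), sq_nonneg z.im]

/-- The points high in the cusp are far from any given orbit. -/
theorem exists_forall_lt_dist_smul (z₀ : ℍ) (R : ℝ) :
    ∃ Y : ℝ, ∀ z : ℍ, Y ≤ z.im → ∀ γ : SL(2, ℤ), R < dist z₀ (γ • z) := by
  refine ⟨Real.exp (|R| + |Real.log z₀.im| + 1), fun z hz γ => ?_⟩
  have hlog : |R| + |Real.log z₀.im| + 1 ≤ Real.log z.im :=
    (Real.le_log_iff_exp_le z.im_pos).2 hz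
  have hd := UpperHalfPlane.dist_log_im_le z₀ (γ • z)
  rw [Real.dist_eq] at hd
  have hR := le_abs_self R
  have h1 := le_abs_self (Real.log z₀.im)
  have h2 := neg_abs_le (Real.log z₀.im)
  rcases im_smul_eq_or_le γ z with h | h
  · rw [h] at hd
    have := neg_abs_le (Real.log z₀.im - Real.log z.im)
    linarith
  · have h3 : Real.log (γ • z).im ≤ -Real.log z.im := by
      rw [← Real.log_inv, ← one_div]
      exact Real.log_le_log (γ • z).im_pos h
    have := le_abs_self (Real.log z₀.im - Real.log (γ • z).im)
    linarith

/-- A set of points of the modular surface which is unbounded for the quotient metric has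
non-compact closure, since the images of the open balls about a point cover the surface. -/
theorem not_isCompact_closure_of_unbounded {S : Set ModularSurface} (z₀ : ℍ)
    (h : ∀ R : ℝ, ∃ z : ℍ, ModularSurface.mk z ∈ S ∧ ∀ γ : SL(2, ℤ), R < dist z₀ (γ • z)) :
    ¬ IsCompact (closure S) := by
  intro hS
  have : ContinuousConstSMul SL(2, ℤ) ℍ :=
    ⟨fun γ => continuous_const_smul (γ.map (Int.castRingHom ℝ) : SL(2, ℝ))⟩
  have hopen : ∀ n : ℕ, IsOpen (ModularSurface.mk '' Metric.ball z₀ n) := fun n =>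
    isOpenMap_quotient_mk'_mul (Γ := SL(2, ℤ)) (T := ℍ) _ Metric.isOpen_ball
  obtain ⟨n, hn⟩ := hS.elim_directed_cover _ hopen (by
      intro x _
      obtain ⟨z, rfl⟩ := Quotient.exists_rep x
      obtain ⟨n, hn⟩ := exists_nat_gt (dist z z₀)
      exact Set.mem_iUnion.2 ⟨n, z, hn, rfl⟩)
    (directed_of_isDirected_le fun m n hmn =>
      Set.image_mono (Metric.ball_subset_ball (by exact_mod_cast hmn)))
  obtain ⟨z, hz, hfar⟩ := h n
  obtain ⟨w, hw, hwz⟩ := hn (subset_closure hz)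
  obtain ⟨γ, rfl⟩ := Quotient.exact hwz
  have := hfar γ
  rw [Metric.mem_ball, dist_comm] at hw
  exact lt_asymm hw this

/-! ### Units of small logarithmic length -/

theorem eq_zero_of_prod_norm_lt_one {K : Type*} [Field K] [NumberField K] {O : Subring K}
    (hO : IsOrder O) {x : K} (hx : x ∈ O) (h : ∏ σ : K →+* ℂ, ‖σ x‖ < 1) : x = 0 := by
  have := hO.finite
  have hint : IsIntegral ℤ x :=
    (Algebra.IsIntegral.isIntegral (R := ℤ) (⟨x, hx⟩ : O)).map (O.subtype.toIntAlgHom)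
  obtain ⟨n, hn⟩ := IsIntegrallyClosed.isIntegral_iff.mp (Algebra.isIntegral_norm ℚ hint)
  have h1 := congrArg norm (Algebra.norm_eq_prod_embeddings ℚ ℂ x)
  rw [norm_prod, ← Equiv.prod_comp (RingHom.equivRatAlgHom (R := K) (S := ℂ))] at h1
  simp only [RingHom.equivRatAlgHom_apply, RingHom.toRatAlgHom_apply] at h1
  rw [← h1, ← hn] at h
  have h2 : |(n : ℝ)| < 1 := by simpa using h
  have h3 : n = 0 := Int.abs_lt_one_iff.1 (by exact_mod_cast h2)
  rw [h3] at hn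
  exact (Algebra.norm_eq_zero_iff (R := ℚ)).1 (by rw [← hn, map_zero])

/-- The logarithmic embedding of a totally real field separates units of an order from `1`, up to
sign, by a uniform amount: if all `|log |σ u||` are less than `1/4` then `u² - 1` has norm less
than one in absolute value. -/
theorem eq_one_or_eq_neg_one_of_abs_log_lt {K : Type*} [Field K] [NumberField K]
    [IsTotallyReal K] {O : Subring K} (hO : IsOrder O) {u : K} (hu : u ∈ O) (hu0 : u ≠ 0)
    (h : ∀ σ : K →+* ℂ, |Real.log ‖σ u‖| < 1 / 4) : u = 1 ∨ u = -1 := by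
  classical
  have key : ∀ σ : K →+* ℂ, ‖σ (u ^ 2 - 1)‖ < 1 := by
    intro σ
    obtain ⟨r, hr⟩ := Complex.conj_eq_iff_real.1
      (RingHom.congr_fun (IsTotallyReal.complexEmbedding_isReal σ) u)
    have hr0 : r ≠ 0 := by
      rintro rfl
      exact hu0 ((map_eq_zero σ).1 (by simpa using hr))
    have hlog := h σ
    rw [hr, Complex.norm_real, Real.norm_eq_abs, Real.log_abs] at hlog
    have hsq : Real.log (r ^ 2) = 2 * Real.log r := by rw [Real.log_pow]; norm_num
    obtain ⟨h1, h2⟩ := abs_lt.1 hlog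
    have hpos : 0 < r ^ 2 := by positivity
    have h3 : r ^ 2 < 2 := by
      rw [← Real.log_lt_log_iff hpos two_pos, hsq]
      linarith [Real.log_two_gt_d9]
    rw [map_sub, map_pow, map_one, hr, ← Complex.ofReal_pow, ← Complex.ofReal_one,
      ← Complex.ofReal_sub, Complex.norm_real, Real.norm_eq_abs, abs_lt]
    constructor <;> linarith
  have h0 := eq_zero_of_prod_norm_lt_one hO (O.sub_mem (O.pow_mem hu 2) O.one_mem) (by
    have : (Finset.univ : Finset (K →+* ℂ)).Nonempty := Finset.univ_nonempty
    calc ∏ σ : K →+* ℂ, ‖σ (u ^ 2 - 1)‖ ≤ _ := ?_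
      _ < 1 := key this.choose
    rw [← Finset.mul_prod_erase _ _ (Finset.mem_univ this.choose)]
    exact mul_le_of_le_one_right (norm_nonneg _)
      (Finset.prod_le_one (fun _ _ => norm_nonneg _) fun σ _ => (key σ).le))
  exact eq_or_eq_neg_of_sq_eq_sq u 1 (by rw [one_pow, sub_eq_zero.1 h0])

/-! ### The orders `{g(θ) : N ∣ g'(0)}` -/

section

open Polynomial

/-- The integral polynomials whose linear coefficient is divisible by `N`. -/
def linearCoeffDvd (N : ℕ) : Subring ℤ[X] where
  carrier := {g | (N : ℤ) ∣ g.coeff 1}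
  mul_mem' {f g} hf hg := by
    simp only [Set.mem_ofPred_eq, mul_coeff_one] at *
    exact dvd_add (hg.mul_left _) (hf.mul_right _)
  one_mem' := by simp [coeff_one]
  add_mem' {f g} hf hg := by
    simp only [Set.mem_ofPred_eq, coeff_add] at *
    exact dvd_add hf hg
  zero_mem' := by simp
  neg_mem' {f} hf := by
    simp only [Set.mem_ofPred_eq, coeff_neg] at *
    exact (dvd_neg).2 hf

theorem mem_linearCoeffDvd {N : ℕ} {g : ℤ[X]} :
    g ∈ linearCoeffDvd N ↔ (N : ℤ) ∣ g.coeff 1 := Iff.rfl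

theorem pow_mem_linearCoeffDvd (N : ℕ) (g : ℤ[X]) : g ^ N ∈ linearCoeffDvd N := by
  have h : (g ^ N).coeff 1 = (derivative (g ^ N)).coeff 0 := by simp [coeff_derivative]
  rw [mem_linearCoeffDvd, h, derivative_pow, mul_assoc, mul_coeff_zero, coeff_C_zero]
  simp

/-- The subring of all `g(θ)` with `g` an integral polynomial whose linear coefficient is
divisible by `N`; it equals `ℤ[θ]` for `N = 1`. -/
noncomputable def linearOrder {K : Type*} [Field K] (θ : K) (N : ℕ) : Subring K :=
  (linearCoeffDvd N).map (aeval θ : ℤ[X] →ₐ[ℤ] K).toRingHom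

section

variable {K : Type*} [Field K]

theorem mem_linearOrder {θ : K} {N : ℕ} {x : K} :
    x ∈ linearOrder θ N ↔ ∃ g : ℤ[X], (N : ℤ) ∣ g.coeff 1 ∧ aeval θ g = x := Iff.rfl

theorem linearOrder_le (θ : K) (N : ℕ) : linearOrder θ N ≤ linearOrder θ 1 := by
  rintro _ ⟨g, -, rfl⟩
  exact ⟨g, mem_linearCoeffDvd.2 (by simp), rfl⟩

theorem isOrder_linearOrder [NumberField K] {θ : K} (hθ : IsIntegral ℤ θ)
    (hgen : ∀ y : K, ∃ q : ℚ[X], aeval θ q = y) {N : ℕ} (hN : N ≠ 0) :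
    IsOrder (linearOrder θ N) where
  finite := by
    have hfin : Module.Finite ℤ (Algebra.adjoin ℤ {θ}) :=
      Module.Finite.iff_fg.2 hθ.fg_adjoin_singleton
    have hle : ∀ x ∈ linearOrder θ N, x ∈ Algebra.adjoin ℤ {θ} := by
      rintro _ ⟨g, -, rfl⟩
      exact aeval_mem_adjoin_singleton ℤ θ
    exact Module.Finite.of_injective
      ({ toFun := fun x => ⟨x, hle x x.2⟩
         map_add' := fun _ _ => rfl
         map_smul' := fun n x => Subtype.ext (by simp) } :
        linearOrder θ N →ₗ[ℤ] Algebra.adjoin ℤ {θ})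
      (fun x y h => Subtype.ext (congrArg (fun z : Algebra.adjoin ℤ {θ} => (z : K)) h))
  span_eq_top := by
    rw [eq_top_iff]
    intro y _
    obtain ⟨q, rfl⟩ := hgen y
    rw [aeval_eq_sum_range]
    refine Submodule.sum_mem _ fun i _ => Submodule.smul_mem _ _ ?_
    have hN' : (N : ℚ) ≠ 0 := Nat.cast_ne_zero.2 hN
    have h : θ ^ i = (N : ℚ)⁻¹ • ((N : ℚ) • θ ^ i) := by
      rw [smul_smul, inv_mul_cancel₀ hN', one_smul]
    rw [h]
    refine Submodule.smul_mem _ _ (Submodule.subset_span ?_)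
    refine mem_linearOrder.2 ⟨C (N : ℤ) * X ^ i, by rw [coeff_C_mul]; exact dvd_mul_right _ _, ?_⟩
    simp [Algebra.smul_def]

/-- If every integral polynomial relation of `θ` is divisible by `X²` modulo `N`, then the
derivation `g ↦ g'(0)` of `ℤ[X]` induces a logarithmic derivative `g(θ) ↦ g'(0) / g(0)` on the
units of `ℤ[θ]`, with values in `ℤ/N`. It vanishes on the units of the order
`linearOrder θ N`. Only its values up to a unit factor of `ℤ/N` are recorded, which suffices to
tell where it vanishes and where it is a generator. -/
theorem exists_logDeriv {θ : K} {N : ℕ}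
    (hrel : ∀ g : ℤ[X], aeval θ g = 0 → (N : ℤ) ∣ g.coeff 0 ∧ (N : ℤ) ∣ g.coeff 1) :
    ∃ χ : Additive (linearOrder θ 1)ˣ →+ ZMod N,
      ∀ (u : (linearOrder θ 1)ˣ) (g : ℤ[X]), aeval θ g = (u : K) →
        ∃ a : (ZMod N)ˣ, χ (Additive.ofMul u) = g.coeff 1 * a := by
  have hwd : ∀ f g : ℤ[X], aeval θ f = aeval θ g →
      (f.coeff 0 : ZMod N) = g.coeff 0 ∧ (f.coeff 1 : ZMod N) = g.coeff 1 := by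
    intro f g h
    have := hrel (f - g) (by rw [map_sub, h, sub_self])
    rw [coeff_sub, coeff_sub, ← CharP.intCast_eq_zero_iff (ZMod N) N,
      ← CharP.intCast_eq_zero_iff (ZMod N) N, Int.cast_sub, Int.cast_sub, sub_eq_zero,
      sub_eq_zero] at this
    exact this
  have hex : ∀ u : (linearOrder θ 1)ˣ, ∃ g : ℤ[X], aeval θ g = (u : K) := fun u => by
    obtain ⟨g, -, hg⟩ := mem_linearOrder.1 (u : linearOrder θ 1).2
    exact ⟨g, hg⟩
  choose p hp using hex
  have hmul0 : ∀ u v, ((p (u * v)).coeff 0 : ZMod N) = (p u).coeff 0 * (p v).coeff 0 := by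
    intro u v
    rw [(hwd (p (u * v)) (p u * p v) (by rw [map_mul, hp, hp, hp]; simp)).1]
    simp
  have hmul1 : ∀ u v, ((p (u * v)).coeff 1 : ZMod N) =
      (p u).coeff 0 * (p v).coeff 1 + (p u).coeff 1 * (p v).coeff 0 := by
    intro u v
    rw [(hwd (p (u * v)) (p u * p v) (by rw [map_mul, hp, hp, hp]; simp)).2]
    simp [mul_coeff_one]
  have hone : ((p 1).coeff 0 : ZMod N) = 1 := by
    rw [(hwd (p 1) 1 (by rw [hp]; simp)).1]; simp
  have hinv : ∀ u, ((p u).coeff 0 : ZMod N) * (p u⁻¹).coeff 0 = 1 := fun u => by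
    rw [← hmul0, mul_inv_cancel, hone]
  refine ⟨AddMonoidHom.mk' (fun u => (p u.toMul).coeff 1 * (p u.toMul⁻¹).coeff 0) ?_, ?_⟩
  · intro u v
    simp only [toMul_add, mul_inv, hmul0, hmul1]
    linear_combination ((p v.toMul).coeff 1 * (p v.toMul⁻¹).coeff 0 : ZMod N) * hinv u.toMul +
      ((p u.toMul).coeff 1 * (p u.toMul⁻¹).coeff 0 : ZMod N) * hinv v.toMul
  · intro u g hg
    refine ⟨⟨(p u⁻¹).coeff 0, (p u).coeff 0, by rw [mul_comm]; exact hinv u, hinv u⟩, ?_⟩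
    rw [← (hwd (p u) g (by rw [hp, hg])).2]
    rfl

theorem exists_unit_linearOrder {θ : K} {N : ℕ} {f g : ℤ[X]} (hf : f ∈ linearCoeffDvd N)
    (hg : g ∈ linearCoeffDvd N) (hfg : aeval θ f * aeval θ g = 1) :
    ∃ u : (linearOrder θ N)ˣ, (u : K) = aeval θ f :=
  ⟨⟨⟨aeval θ f, f, hf, rfl⟩, ⟨aeval θ g, g, hg, rfl⟩, Subtype.ext hfg,
    Subtype.ext ((mul_comm _ _).trans hfg)⟩, rfl⟩

end

/-! ### Totally real cubic fields from cubic polynomials -/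

/-- A monic integral cubic, irreducible over `ℚ` and with three real roots, defines a totally real
cubic field. Its three real embeddings are all its embeddings because of their number. -/
theorem exists_totallyReal_cubic {P : ℤ[X]} (hmonic : P.Monic) (hdeg : P.natDegree = 3)
    (hirr : Irreducible (P.map (Int.castRingHom ℚ))) {r : Fin 3 → ℝ} (hr : Function.Injective r)
    (hroot : ∀ i, aeval (r i) P = 0) :
    ∃ (K : Type) (_ : Field K) (_ : NumberField K) (θ : K), IsTotallyReal K ∧
      Module.finrank ℚ K = 3 ∧ IsIntegral ℤ θ ∧ (∀ y : K, ∃ q : ℚ[X], aeval θ q = y) ∧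
      (∀ g : ℤ[X], aeval θ g = 0 → P ∣ g) ∧ aeval θ P = 0 ∧
      ∃ σ : Fin 3 → (K →+* ℂ), Function.Bijective σ ∧ ∀ i, σ i θ = r i := by
  set Q := P.map (Int.castRingHom ℚ) with hQ
  have : Fact (Irreducible Q) := ⟨hirr⟩
  have hQm : Q.Monic := hmonic.map _
  have hQ0 : Q ≠ 0 := hQm.ne_zero
  have hQd : Q.natDegree = 3 := by rw [hQ, hmonic.natDegree_map, hdeg]
  have hfd : FiniteDimensional ℚ (AdjoinRoot Q) := (AdjoinRoot.powerBasis hQ0).finite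
  have hNF : NumberField (AdjoinRoot Q) := { }
  have hrank : Module.finrank ℚ (AdjoinRoot Q) = 3 := by
    rw [(AdjoinRoot.powerBasis hQ0).finrank, AdjoinRoot.powerBasis_dim, hQd]
  have hθ : aeval (AdjoinRoot.root Q) P = 0 := by
    have := AdjoinRoot.eval₂_root Q
    rw [hQ, eval₂_map] at this
    rw [aeval_def]
    convert this using 1
    congr 1
  have hlift : ∀ i, eval₂ (algebraMap ℚ ℂ) (r i : ℂ) Q = 0 := by
    intro i
    have h1 := congrArg (algebraMap ℝ ℂ) (hroot i)
    rw [← aeval_algebraMap_apply, map_zero, aeval_def] at h1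
    rw [hQ, eval₂_map]
    convert h1 using 1
    congr 1
  set σ : Fin 3 → (AdjoinRoot Q →+* ℂ) := fun i => AdjoinRoot.lift (algebraMap ℚ ℂ) (r i) (hlift i)
  have hσ : ∀ i, σ i (AdjoinRoot.root Q) = r i := fun i => AdjoinRoot.lift_root (hlift i)
  have hbij : Function.Bijective σ := by
    rw [Fintype.bijective_iff_injective_and_card]
    refine ⟨fun i j h => hr ?_, ?_⟩
    · have := RingHom.congr_fun h (AdjoinRoot.root Q)
      rw [hσ, hσ] at this
      exact_mod_cast this
    · rw [NumberField.Embeddings.card, hrank, Fintype.card_fin]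
  have haev : ∀ q : ℚ[X], aeval (AdjoinRoot.root Q) q = AdjoinRoot.mk Q q :=
    fun q => AdjoinRoot.aeval_eq q
  have hgen : ∀ y : AdjoinRoot Q, ∃ q : ℚ[X], aeval (AdjoinRoot.root Q) q = y := fun y => by
    obtain ⟨q, rfl⟩ := AdjoinRoot.mk_surjective y
    exact ⟨q, haev q⟩
  refine ⟨AdjoinRoot Q, inferInstance, hNF, AdjoinRoot.root Q, ⟨fun w => ?_⟩, hrank,
    ⟨P, hmonic, hθ⟩, hgen, ?_, hθ, σ, hbij, hσ⟩
  · rw [InfinitePlace.isReal_iff]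
    obtain ⟨i, hi⟩ := hbij.2 w.embedding
    rw [← hi, ComplexEmbedding.isReal_iff]
    refine RingHom.ext fun y => ?_
    obtain ⟨q, rfl⟩ := hgen y
    rw [aeval_eq_sum_range]
    simp [Algebra.smul_def, hσ]
  · intro g hg
    rw [← map_dvd_map (Int.castRingHom ℚ) (RingHom.injective_int _) hmonic]
    have h2 : aeval (AdjoinRoot.root Q) (g.map (Int.castRingHom ℚ)) = 0 := by
      rw [← hg, aeval_def, aeval_def, eval₂_map]
      congr 1
    rw [haev, AdjoinRoot.mk_eq_zero] at h2
    exact h2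

/-! ### The family `(X + u) (X + v) (X + w) - 1` -/

/-- The cubic `(X + u) (X + v) (X + w) - 1`. At a root `θ` the three factors are units with
product one. -/
noncomputable def unitCubic (u v w : ℤ) : ℤ[X] :=
  (X + C u) * (X + C v) * (X + C w) - 1

theorem unitCubic_monic_natDegree (u v w : ℤ) :
    (unitCubic u v w).Monic ∧ (unitCubic u v w).natDegree = 3 := by
  have hm : ((X + C u) * (X + C v) * (X + C w)).Monic :=
    ((monic_X_add_C _).mul (monic_X_add_C _)).mul (monic_X_add_C _)
  have hd : ((X + C u) * (X + C v) * (X + C w)).natDegree = 3 := by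
    rw [((monic_X_add_C _).mul (monic_X_add_C _)).natDegree_mul (monic_X_add_C _),
      (monic_X_add_C _).natDegree_mul (monic_X_add_C _), natDegree_X_add_C, natDegree_X_add_C,
      natDegree_X_add_C]
  have hlt : (1 : ℤ[X]).natDegree < ((X + C u) * (X + C v) * (X + C w)).natDegree := by
    rw [hd]; simp
  refine ⟨hm.sub_of_left (degree_lt_degree hlt), ?_⟩
  rw [unitCubic, natDegree_sub_eq_left_of_natDegree_lt hlt, hd]

/-- A rational root would be an integer at which the factors are `±1`, although the shifts
`u` and `w` are more than two apart. -/
theorem unitCubic_irreducible {u v w : ℤ} (huw : u + 2 < w) :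
    Irreducible ((unitCubic u v w).map (Int.castRingHom ℚ)) := by
  obtain ⟨hm, hd⟩ := unitCubic_monic_natDegree u v w
  have hd' : ((unitCubic u v w).map (Int.castRingHom ℚ)).natDegree = 3 := by
    rw [hm.natDegree_map, hd]
  rw [irreducible_iff_roots_eq_zero_of_degree_le_three (by omega) (by omega),
    Multiset.eq_zero_iff_forall_notMem]
  intro x hx
  have h1 : aeval x (unitCubic u v w) = 0 := by
    have := (mem_roots'.1 hx).2
    rw [IsRoot.def, eval_map] at this
    rw [aeval_def]
    exact this
  obtain ⟨n, rfl⟩ := isInteger_of_is_root_of_monic hm h1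
  have h2 : (n + u) * (n + v) * (n + w) = 1 := by
    simp only [unitCubic, map_sub, map_mul, map_add, aeval_X, aeval_C, map_one] at h1
    rw [← map_add, ← map_add, ← map_add, ← map_mul, ← map_mul, sub_eq_zero] at h1
    exact (RingHom.injective_int (algebraMap ℤ ℚ)) (by rw [h1, map_one])
  have hw : IsUnit (n + w) := IsUnit.of_mul_eq_one_right _ h2
  have hu : IsUnit (n + u) := by
    rw [mul_assoc] at h2
    exact IsUnit.of_mul_eq_one _ h2
  rcases Int.isUnit_iff.1 hw with h | h <;> rcases Int.isUnit_iff.1 hu with h' | h' <;> linarith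

theorem exists_roots_unitCubic {u v w : ℤ} (huw : u + 2 < w) (hwv : w + 2 < v) :
    ∃ r : Fin 3 → ℝ, (∀ i, aeval (r i) (unitCubic u v w) = 0) ∧
      r 0 ∈ Set.Ioo (-u : ℝ) (-u + 1) ∧ r 1 ∈ Set.Ioo (-v : ℝ) (-v + 1) ∧
      r 2 ∈ Set.Ioo (-w - 1 : ℝ) (-w) := by
  have huw' : (u : ℝ) + 2 < w := by exact_mod_cast huw
  have hwv' : (w : ℝ) + 2 < v := by exact_mod_cast hwv
  set f : ℝ → ℝ := fun x => (x + u) * (x + v) * (x + w) - 1 with hf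
  have hcont : Continuous f := by fun_prop
  have haeval : ∀ x : ℝ, aeval x (unitCubic u v w) = f x := by
    intro x
    simp [unitCubic, hf]
  obtain ⟨a, ha, ha0⟩ := intermediate_value_Ioo (a := (-u : ℝ)) (b := -u + 1) (by linarith)
    hcont.continuousOn (show (0 : ℝ) ∈ Set.Ioo _ _ by
      simp only [hf]; constructor <;> nlinarith)
  obtain ⟨b, hb, hb0⟩ := intermediate_value_Ioo (a := (-v : ℝ)) (b := -v + 1) (by linarith)
    hcont.continuousOn (show (0 : ℝ) ∈ Set.Ioo _ _ by
      simp only [hf]; constructor <;> nlinarith)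
  obtain ⟨c, hc, hc0⟩ := intermediate_value_Ioo' (a := (-w - 1 : ℝ)) (b := -w) (by linarith)
    hcont.continuousOn (show (0 : ℝ) ∈ Set.Ioo _ _ by
      simp only [hf]; constructor <;> nlinarith)
  refine ⟨![a, b, c], fun i => ?_, ha, hb, hc⟩
  rw [haeval]
  fin_cases i
  · exact ha0
  · exact hb0
  · exact hc0

/-- If `N` divides the two lowest coefficients of the cubic, which is then divisible by `X²`
modulo `N`, then it divides those of every multiple. -/
theorem dvd_coeff_of_unitCubic_dvd {u v w N : ℤ} (h0 : N ∣ u * v * w - 1)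
    (h1 : N ∣ u * v + u * w + v * w) {g : ℤ[X]} (h : unitCubic u v w ∣ g) :
    N ∣ g.coeff 0 ∧ N ∣ g.coeff 1 := by
  obtain ⟨q, rfl⟩ := h
  have e0 : (unitCubic u v w).coeff 0 = u * v * w - 1 := by
    simp [unitCubic]
  have e1 : (unitCubic u v w).coeff 1 = u * v + u * w + v * w := by
    have hC : ∀ a : ℤ, (C a).coeff 1 = 0 := fun a => coeff_C_of_ne_zero one_ne_zero
    simp only [unitCubic, coeff_sub, mul_coeff_one, mul_coeff_zero, coeff_add, coeff_X_one,
      coeff_X_zero, coeff_C_zero, hC, coeff_one, one_ne_zero, if_false]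
    ring
  rw [mul_coeff_zero, mul_coeff_one, e0, e1]
  exact ⟨h0.mul_right _, dvd_add (h0.mul_right _) (h1.mul_right _)⟩

/-! ### Shapes of the orders `linearOrder θ N` -/

/-- The logarithmic embedding of the units of an order, as a homomorphism to the trace-zero
hyperplane. -/
noncomputable def unitLog {K : Type*} [Field K] [NumberField K] {O : Subring K} (hO : IsOrder O) :
    Additive Oˣ →+ traceZero K :=
  AddMonoidHom.mk' (fun u : Additive Oˣ =>
    (⟨logEmbedding K (Units.map (O.subtype : O →* K) u.toMul),
      logEmbedding_mem_traceZero hO u.toMul⟩ : traceZero K))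
    (fun u v => Subtype.ext (by
      simp only [toMul_add, map_mul, logEmbedding_mul, Submodule.coe_add]))

section

variable {K : Type*} [Field K] [NumberField K]

theorem unitLog_apply {O : Subring K} (hO : IsOrder O) (u : Oˣ) (σ : K →+* ℂ) :
    (unitLog hO (Additive.ofMul u) : EuclideanSpace ℝ (K →+* ℂ)) σ =
      Real.log ‖σ ((u : O) : K)‖ := rfl

theorem unitLog_eq_zero_iff [IsTotallyReal K] {O : Subring K} (hO : IsOrder O) {u : Oˣ} :
    unitLog hO (Additive.ofMul u) = 0 ↔ ((u : O) : K) = 1 ∨ ((u : O) : K) = -1 := by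
  constructor
  · intro h
    refine eq_one_or_eq_neg_one_of_abs_log_lt hO u.1.2 (by simp) fun σ => ?_
    rw [← unitLog_apply hO, h]
    simp
  · intro h
    refine Subtype.ext (PiLp.ext fun σ => ?_)
    rw [unitLog_apply]
    rcases h with h | h <;> simp [h]

theorem le_norm_unitLog [IsTotallyReal K] {O : Subring K} (hO : IsOrder O) {u : Additive Oˣ}
    (hu : unitLog hO u ≠ 0) : 1 / 4 ≤ ‖unitLog hO u‖ := by
  by_contra! h
  refine hu ((unitLog_eq_zero_iff hO (u := u.toMul)).2
    (eq_one_or_eq_neg_one_of_abs_log_lt hO u.toMul.1.2 (by simp) fun σ => ?_))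
  rw [← unitLog_apply hO, ← Real.norm_eq_abs]
  exact (PiLp.norm_apply_le _ σ).trans_lt h

/-- If the logarithmic derivative at the double root `0` modulo `N` takes a unit value, the unit
lattice of `linearOrder θ N` has covolume at least `N / 32`. Hence every vector of it forces the
shape up to a corresponding height in the cusp. -/
theorem exists_shape_le_im [IsTotallyReal K] {θ : K} {N : ℕ}
    (hO₁ : IsOrder (linearOrder θ 1)) (hO : IsOrder (linearOrder θ N))
    (hrel : ∀ g : ℤ[X], aeval θ g = 0 → (N : ℤ) ∣ g.coeff 0 ∧ (N : ℤ) ∣ g.coeff 1)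
    (hη : ∃ (η : (linearOrder θ 1)ˣ) (g : ℤ[X]), aeval θ g = (η : K) ∧ g.coeff 1 = 1)
    (E : traceZero K ≃ₗᵢ[ℝ] EuclideanSpace ℝ (Fin 2)) {x y : traceZero K}
    (hx : x ∈ unitLattice hO) (hy : y ∈ unitLattice hO) (hxy : LinearIndependent ℝ ![x, y]) :
    ∃ z : ℍ, IsLatticeShape
      ((unitLattice hO).map E.toLinearEquiv.toLinearMap.toAddMonoidHom) (ModularSurface.mk z) ∧
      N / 32 / ‖x‖ ^ 2 ≤ z.im := by
  obtain ⟨χ, hχ⟩ := exists_logDeriv hrel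
  set E' : traceZero K →+ EuclideanSpace ℝ (Fin 2) :=
    E.toLinearEquiv.toLinearMap.toAddMonoidHom with hE'
  have hE : ∀ a, E' a = E a := fun a => rfl
  set ℓ : Additive (linearOrder θ 1)ˣ →+ EuclideanSpace ℝ (Fin 2) := E'.comp (unitLog hO₁)
  have hℓ : ∀ g, ℓ g = E (unitLog hO₁ g) := fun g => rfl
  have hker : ∀ g, ℓ g = 0 → χ g = 0 := by
    intro g hg
    rw [hℓ, E.map_eq_zero_iff] at hg
    rcases (unitLog_eq_zero_iff hO₁ (u := g.toMul)).1 hg with h | h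
    · obtain ⟨a, ha⟩ := hχ g.toMul 1 (by rw [h, map_one])
      rw [coeff_one, if_neg one_ne_zero, Int.cast_zero, zero_mul] at ha
      exact ha
    · obtain ⟨a, ha⟩ := hχ g.toMul (-1) (by rw [h, map_neg, map_one])
      rw [coeff_neg, coeff_one, if_neg one_ne_zero, neg_zero, Int.cast_zero, zero_mul] at ha
      exact ha
  have hunit : ∃ g, IsUnit (χ g) := by
    obtain ⟨η, g, hg, hg1⟩ := hη
    obtain ⟨a, ha⟩ := hχ η g hg
    refine ⟨Additive.ofMul η, ?_⟩
    rw [ha, hg1, Int.cast_one, one_mul]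
    exact a.isUnit
  have hmin : ∀ g, ℓ g ≠ 0 → 1 / 4 ≤ ‖ℓ g‖ := by
    intro g hg
    rw [hℓ, E.norm_map]
    refine le_norm_unitLog hO₁ fun h => hg ?_
    rw [hℓ, h, E.map_zero]
  have hlift : ∀ v ∈ (unitLattice hO).map E', ∃ g, χ g = 0 ∧ ℓ g = v := by
    rintro _ ⟨_, ⟨u, rfl⟩, rfl⟩
    refine ⟨Additive.ofMul
      (Units.map (Subring.inclusion (linearOrder_le θ N)).toMonoidHom u.toMul), ?_, rfl⟩
    obtain ⟨g, hg1, hg⟩ := mem_linearOrder.1 (u.toMul : linearOrder θ N).2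
    obtain ⟨a, ha⟩ := hχ
      (Units.map (Subring.inclusion (linearOrder_le θ N)).toMonoidHom u.toMul) g hg
    rw [ha, (CharP.intCast_eq_zero_iff (ZMod N) N _).2 hg1, zero_mul]
  have hxE : E' x ∈ (unitLattice hO).map E' := ⟨x, hx, rfl⟩
  have hyE : E' y ∈ (unitLattice hO).map E' := ⟨y, hy, rfl⟩
  have hli : LinearIndependent ℝ ![E' x, E' y] := by
    rw [LinearIndependent.pair_iff] at hxy ⊢
    intro s t hst
    refine hxy s t (E.injective ?_)
    rw [E.map_add, E.map_smul, E.map_smul, E.map_zero]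
    exact hst
  obtain ⟨b₁, b₂, hb, hcl⟩ := exists_oriented_basis (c := 1 / 4) (by norm_num)
    (by
      intro v hv hv0
      obtain ⟨g, -, rfl⟩ := hlift v hv
      exact hmin g hv0) hxE hyE hli
  have harea := le_area_of_character ℓ χ hker hunit (c := 1 / 4) (by norm_num) hmin
    (hlift b₁ (by rw [hcl]; exact AddSubgroup.subset_closure (by simp)))
    (hlift b₂ (by rw [hcl]; exact AddSubgroup.subset_closure (by simp))) hb
  have hx0 : E' x ≠ 0 := by
    have := hli.ne_zero 0
    simpa using this
  obtain ⟨γ, hγ⟩ := exists_area_div_le_im hb (by rw [← hcl]; exact hxE) hx0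
  refine ⟨γ • unimodularMatrix b₁ b₂ hb • UpperHalfPlane.I, ?_, ?_⟩
  · rw [ModularSurface.mk_smul, hcl]
    exact isLatticeShape_unimodularMatrix hb
  · refine le_trans ?_ hγ
    rw [hE, E.norm_map]
    have : (N : ℝ) / 32 ≤ area b₁ b₂ := by linarith
    gcongr

end

/-- In terms of the units `A = θ + u`, `B = θ + v`, `C = θ + w` with `A B C = 1`, the short vector
comes from `A² C = A / B`. At the root near `-u` only `A`, and at the root near `-v` only `B`, is
less than one in absolute value, which makes `A / B` and `C` independent. -/
theorem exists_mem_shapeSet_le_im (e : PlaneIdentification) {u v w : ℤ} {N : ℕ} (hN : N ≠ 0)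
    (huw : u + 2 < w) (hwv : w + 2 < v) (h0 : (N : ℤ) ∣ u * v * w - 1)
    (h1 : (N : ℤ) ∣ u * v + u * w + v * w) (hu : (N : ℤ) ∣ u ^ 2 + 2 * u * w)
    (hv : (N : ℤ) ∣ v ^ 2 + 2 * v * w) :
    ∃ z : ℍ, ModularSurface.mk z ∈ shapeSet e ∧
      N / 32 / (27 * Real.log (v - u + 1) ^ 2) ≤ z.im := by
  have huw' : (u : ℝ) + 2 < w := by exact_mod_cast huw
  have hwv' : (w : ℝ) + 2 < v := by exact_mod_cast hwv
  obtain ⟨r, hroot, hr0, hr1, hr2⟩ := exists_roots_unitCubic huw hwv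
  have hinj : Function.Injective r := by
    have h01 : r 1 < r 0 := by linarith [hr0.1, hr1.2]
    have h02 : r 2 < r 0 := by linarith [hr0.1, hr2.2]
    have h12 : r 1 < r 2 := by linarith [hr1.2, hr2.1]
    intro i j hij
    fin_cases i <;> fin_cases j <;> first | rfl | (exfalso; simp at hij; linarith)
  obtain ⟨K, _, _, θ, _, hrank, hint, hgen, hdvd, hθ, σ, hσ, hσθ⟩ :=
    exists_totallyReal_cubic (unitCubic_monic_natDegree u v w).1
      (unitCubic_monic_natDegree u v w).2 (unitCubic_irreducible huw) hinj hroot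
  have hO := isOrder_linearOrder hint hgen hN
  have hO₁ := isOrder_linearOrder hint hgen one_ne_zero
  have hABC : (θ + u) * (θ + v) * (θ + w) = 1 := by
    simpa [unitCubic, sub_eq_zero] using hθ
  have hC1 : ∀ a : ℤ, (C a).coeff 1 = 0 := fun a => coeff_C_of_ne_zero one_ne_zero
  have hquad : ∀ a : ℤ, ((X + C a) ^ 2 * (X + C w)).coeff 1 = a ^ 2 + 2 * a * w := by
    intro a
    simp only [pow_two, mul_coeff_one, mul_coeff_zero, coeff_add, coeff_X_one, coeff_X_zero,
      coeff_C_zero, hC1]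
    ring
  obtain ⟨η, hη⟩ : ∃ η : (linearOrder θ 1)ˣ, (η : K) = aeval θ (X + C w) :=
    exists_unit_linearOrder (g := (X + C u) * (X + C v)) (mem_linearCoeffDvd.2 (by simp))
      (mem_linearCoeffDvd.2 (by simp)) (by simp; linear_combination hABC)
  obtain ⟨ε, hε⟩ : ∃ ε : (linearOrder θ N)ˣ, (ε : K) = aeval θ ((X + C u) ^ 2 * (X + C w)) :=
    exists_unit_linearOrder (g := (X + C v) ^ 2 * (X + C w))
      (mem_linearCoeffDvd.2 (by rw [hquad]; exact hu))
      (mem_linearCoeffDvd.2 (by rw [hquad]; exact hv))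
      (by
        simp
        linear_combination ((θ + u) * (θ + v) * (θ + w) + 1) * hABC)
  -- `C` itself need not lie in the order, but its `N`-th power does.
  obtain ⟨δ, hδ⟩ : ∃ δ : (linearOrder θ N)ˣ, (δ : K) = aeval θ ((X + C w) ^ N) :=
    exists_unit_linearOrder (g := ((X + C u) * (X + C v)) ^ N) (pow_mem_linearCoeffDvd _ _)
      (pow_mem_linearCoeffDvd _ _)
      (by
        rw [map_pow, map_pow, ← mul_pow, ← map_mul]
        have : aeval θ ((X + C w) * ((X + C u) * (X + C v))) = 1 := by
          simp; linear_combination hABC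
        rw [this, one_pow])
  -- The logarithms are taken of absolute values of real numbers, since `σ i θ = r i` is real.
  have hprod : ∀ i, |r i + u| * |r i + v| * |r i + w| = 1 := by
    intro i
    have : (r i + u) * (r i + v) * (r i + w) = 1 := by
      simpa [unitCubic, sub_eq_zero] using hroot i
    rw [← abs_mul, ← abs_mul, this, abs_one]
  have hpos : ∀ i, 0 < |r i + u| ∧ 0 < |r i + v| ∧ 0 < |r i + w| := by
    intro i
    have h := hprod i
    refine ⟨abs_pos.2 ?_, abs_pos.2 ?_, abs_pos.2 ?_⟩ <;>
    · intro hz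
      rw [hz] at h
      simp at h
  have hsum : ∀ i, Real.log |r i + u| + Real.log |r i + v| + Real.log |r i + w| = 0 := by
    intro i
    obtain ⟨ha, hb, hc⟩ := hpos i
    rw [← Real.log_mul ha.ne' hb.ne', ← Real.log_mul (mul_pos ha hb).ne' hc.ne', hprod,
      Real.log_one]
  have hlogε : ∀ i, (unitLog hO (Additive.ofMul ε) : EuclideanSpace ℝ (K →+* ℂ)) (σ i) =
      2 * Real.log |r i + u| + Real.log |r i + w| := by
    intro i
    obtain ⟨ha, -, hc⟩ := hpos i
    have : σ i (ε : K) = ((r i + u) ^ 2 * (r i + w) : ℝ) := by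
      rw [hε]; simp [hσθ]
    rw [unitLog_apply, this, Complex.norm_real, Real.norm_eq_abs, abs_mul, abs_pow,
      Real.log_mul (pow_pos ha 2).ne' hc.ne', Real.log_pow]
    norm_num
  have hlogδ : ∀ i, (unitLog hO (Additive.ofMul δ) : EuclideanSpace ℝ (K →+* ℂ)) (σ i) =
      N * Real.log |r i + w| := by
    intro i
    have : σ i (δ : K) = ((r i + w) ^ N : ℝ) := by
      rw [hδ]; simp [hσθ]
    rw [unitLog_apply, this, Complex.norm_real, Real.norm_eq_abs, abs_pow, Real.log_pow]
  have hli : LinearIndependent ℝ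
      ![unitLog hO (Additive.ofMul ε), unitLog hO (Additive.ofMul δ)] := by
    rw [LinearIndependent.pair_iff]
    intro s t hst
    have heq : ∀ i, s * (2 * Real.log |r i + u| + Real.log |r i + w|) +
        t * (N * Real.log |r i + w|) = 0 := by
      intro i
      rw [← hlogε, ← hlogδ]
      have := congrArg (fun a : traceZero K => (a : EuclideanSpace ℝ (K →+* ℂ)) (σ i)) hst
      simpa using this
    have a0 : Real.log |r 0 + u| < 0 := Real.log_neg (hpos 0).1 (by
      rw [abs_lt]; constructor <;> linarith [hr0.1, hr0.2])
    have b0 : 0 < Real.log |r 0 + v| := Real.log_pos (by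
      rw [lt_abs]; left; linarith [hr0.1, hr0.2])
    have c0 : 0 < Real.log |r 0 + w| := Real.log_pos (by
      rw [lt_abs]; left; linarith [hr0.1, hr0.2])
    have a1 : 0 < Real.log |r 1 + u| := Real.log_pos (by
      rw [lt_abs]; right; linarith [hr1.1, hr1.2])
    have b1 : Real.log |r 1 + v| < 0 := Real.log_neg (hpos 1).2.1 (by
      rw [abs_lt]; constructor <;> linarith [hr1.1, hr1.2])
    have c1 : 0 < Real.log |r 1 + w| := Real.log_pos (by
      rw [lt_abs]; right; linarith [hr1.1, hr1.2])
    have s0 := hsum 0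
    have s1 := hsum 1
    have e0 := heq 0
    have e1 := heq 1
    have hneg : (2 * Real.log |r 0 + u| + Real.log |r 0 + w|) * Real.log |r 1 + w| -
        (2 * Real.log |r 1 + u| + Real.log |r 1 + w|) * Real.log |r 0 + w| < 0 := by
      have h2 : 2 * Real.log |r 0 + u| + Real.log |r 0 + w| < 0 := by linarith
      have h3 : 0 < 2 * Real.log |r 1 + u| + Real.log |r 1 + w| := by linarith
      linarith [mul_neg_of_neg_of_pos h2 c1, mul_pos h3 c0]
    have hs : s = 0 := (mul_eq_zero.1 (show s * _ = 0 by
      linear_combination Real.log |r 1 + w| * e0 - Real.log |r 0 + w| * e1)).resolve_right hneg.ne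
    refine ⟨hs, ?_⟩
    rw [hs, zero_mul, zero_add] at e0
    exact (mul_eq_zero.1 e0).resolve_right (mul_ne_zero (Nat.cast_ne_zero.2 hN) c0.ne')
  -- All roots lie in `[-v, -u + 1]`.
  have hM : ∀ i, |r i + u| ≤ v - u + 1 ∧ |r i + v| ≤ v - u + 1 ∧ |r i + w| ≤ v - u + 1 := by
    intro i
    have hlo : (-v : ℝ) ≤ r i := by
      fin_cases i
      · exact (by linarith [hr0.1] : (-v : ℝ) ≤ r 0)
      · exact hr1.1.le
      · exact (by linarith [hr2.1] : (-v : ℝ) ≤ r 2)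
    have hhi : r i ≤ -u + 1 := by
      fin_cases i
      · exact hr0.2.le
      · exact (by linarith [hr1.2] : r 1 ≤ -u + 1)
      · exact (by linarith [hr2.2] : r 2 ≤ -u + 1)
    refine ⟨abs_le.2 ⟨?_, ?_⟩, abs_le.2 ⟨?_, ?_⟩, abs_le.2 ⟨?_, ?_⟩⟩ <;> linarith
  -- The lower bound uses `log |A| + log |B| + log |C| = 0`, that is `A² C = (B² C)⁻¹`.
  have hbound : ∀ i, abs (2 * Real.log |r i + u| + Real.log |r i + w|) ≤
      3 * Real.log (v - u + 1) := by
    intro i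
    obtain ⟨ha, hb, hc⟩ := hpos i
    obtain ⟨hMa, hMb, hMc⟩ := hM i
    have := hsum i
    have la := Real.log_le_log ha hMa
    have lb := Real.log_le_log hb hMb
    have lc := Real.log_le_log hc hMc
    rw [abs_le]
    constructor <;> linarith
  have hnorm : ‖unitLog hO (Additive.ofMul ε)‖ ^ 2 ≤ 27 * Real.log (v - u + 1) ^ 2 := by
    rw [Submodule.coe_norm, EuclideanSpace.norm_sq_eq,
      ← Equiv.sum_comp (Equiv.ofBijective σ hσ)]
    calc _ ≤ ∑ _i : Fin 3, (3 * Real.log (v - u + 1)) ^ 2 := by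
          refine Finset.sum_le_sum fun i _ => ?_
          rw [Equiv.ofBijective_apply, hlogε, Real.norm_eq_abs]
          exact pow_le_pow_left₀ (abs_nonneg _) (hbound i) 2
      _ = _ := by rw [Finset.sum_const]; simp; ring
  have hnorm0 : 0 < ‖unitLog hO (Additive.ofMul ε)‖ ^ 2 :=
    pow_pos (norm_pos_iff.2 (by simpa using hli.ne_zero 0)) 2
  obtain ⟨z, hz, hzim⟩ := exists_shape_le_im hO₁ hO
    (fun g hg => dvd_coeff_of_unitCubic_dvd h0 h1 (hdvd g hg))
    ⟨η, X + C w, hη.symm, by rw [coeff_add, coeff_X_one, hC1, add_zero]⟩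
    (e ⟨K, hrank, linearOrder θ N, hO⟩) ⟨_, rfl⟩ ⟨_, rfl⟩ hli
  refine ⟨z, ⟨⟨K, hrank, linearOrder θ N, hO⟩, hz⟩,
    (div_le_div_of_nonneg_left (by positivity) hnorm0 hnorm).trans hzim⟩

/-- The parameters `u = -2t`, `v = 4t³ - 1 - 2t`, `w = t` satisfy the congruences modulo
`N = 4t³ - 1`, so the height of the shape is at least of the order of `N / log² t`. -/
theorem exists_mem_shapeSet_im_ge (e : PlaneIdentification) (Y : ℝ) :
    ∃ z : ℍ, ModularSurface.mk z ∈ shapeSet e ∧ Y ≤ z.im := by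
  obtain ⟨t, ht⟩ := exists_nat_ge (max 2 (2592 * Y))
  have ht2 : (2 : ℝ) ≤ t := (le_max_left _ _).trans ht
  have htY : 2592 * Y ≤ t := (le_max_right _ _).trans ht
  have ht2' : (2 : ℤ) ≤ t := by exact_mod_cast ht2
  have hcube : 1 ≤ 4 * t ^ 3 := by
    have : 1 ≤ t ^ 3 := Nat.one_le_pow _ _ (by omega)
    omega
  have hNZ : ((4 * t ^ 3 - 1 : ℕ) : ℤ) = 4 * (t : ℤ) ^ 3 - 1 := by
    push_cast [Nat.cast_sub hcube]
    ring
  have hNR : ((4 * t ^ 3 - 1 : ℕ) : ℝ) = 4 * (t : ℝ) ^ 3 - 1 := by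
    push_cast [Nat.cast_sub hcube]
    ring
  have ht4 : 4 * (t : ℤ) ≤ t ^ 3 := by
    have : 4 ≤ (t : ℤ) ^ 2 := by nlinarith
    nlinarith
  have ht4' : 4 * (t : ℝ) ≤ t ^ 3 := by exact_mod_cast ht4
  obtain ⟨z, hz, hzim⟩ := exists_mem_shapeSet_le_im e (u := -2 * t) (v := 4 * t ^ 3 - 1 - 2 * t)
    (w := t) (N := 4 * t ^ 3 - 1) (by omega) (by linarith) (by linarith)
    (by rw [hNZ]; exact ⟨1 - 2 * t ^ 2, by ring⟩) (by rw [hNZ]; exact ⟨-t, by ring⟩)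
    ⟨0, by ring⟩ (by rw [hNZ]; exact ⟨4 * t ^ 3 - 1 - 2 * t, by ring⟩)
  refine ⟨z, hz, le_trans ?_ hzim⟩
  have hM : ((4 * (t : ℤ) ^ 3 - 1 - 2 * t : ℤ) : ℝ) - ((-2 * t : ℤ) : ℝ) + 1 = 4 * (t : ℝ) ^ 3 := by
    push_cast; ring
  rw [hM, hNR]
  have hlog0 : 0 < Real.log (4 * (t : ℝ) ^ 3) := Real.log_pos (by linarith)
  have hlog : Real.log (4 * (t : ℝ) ^ 3) ≤ 3 * t := by
    have h4 : Real.log 4 ≤ 3 := by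
      have := Real.log_le_sub_one_of_pos (show (0 : ℝ) < 4 by norm_num)
      linarith
    have hl := Real.log_le_sub_one_of_pos (show (0 : ℝ) < t by linarith)
    rw [Real.log_mul (by norm_num) (by positivity), Real.log_pow]
    push_cast
    linarith
  have hsq : Real.log (4 * (t : ℝ) ^ 3) ^ 2 ≤ (3 * t) ^ 2 := pow_le_pow_left₀ hlog0.le hlog 2
  rw [div_div, le_div_iff₀ (by positivity)]
  rcases le_or_gt Y 0 with hY | hY
  · have : Y * (32 * (27 * Real.log (4 * (t : ℝ) ^ 3) ^ 2)) ≤ 0 :=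
      mul_nonpos_of_nonpos_of_nonneg hY (by positivity)
    linarith
  · calc Y * (32 * (27 * Real.log (4 * (t : ℝ) ^ 3) ^ 2)) ≤ Y * (32 * (27 * (3 * t) ^ 2)) := by
          gcongr
      _ = 2592 * Y * (3 * t ^ 2) := by ring
      _ ≤ t * (3 * t ^ 2) := by gcongr
      _ ≤ 4 * t ^ 3 - 1 := by nlinarith

end

/-- For every choice of isometric identifications of the trace-zero hyperplanes with `ℝ²`
(a change of identification replaces a shape at most by its mirror image), the set of shapes has
non-compact closure in the modular surface, and it is unbounded for the metric induced by the
hyperbolic metric. -/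
theorem theorem1 (e : PlaneIdentification) :
    ¬ IsCompact (closure (shapeSet e)) ∧
      ∀ (z₀ : ℍ) (R : ℝ), ∃ z : ℍ, ModularSurface.mk z ∈ shapeSet e ∧
        ∀ γ : SL(2, ℤ), R < dist z₀ (γ • z) := by
  have h : ∀ (z₀ : ℍ) (R : ℝ), ∃ z : ℍ, ModularSurface.mk z ∈ shapeSet e ∧
      ∀ γ : SL(2, ℤ), R < dist z₀ (γ • z) := by
    intro z₀ R
    obtain ⟨Y, hY⟩ := exists_forall_lt_dist_smul z₀ R
    obtain ⟨z, hz, hzY⟩ := exists_mem_shapeSet_im_ge e Y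
    exact ⟨z, hz, hY z hzY⟩
  exact ⟨not_isCompact_closure_of_unbounded UpperHalfPlane.I (h UpperHalfPlane.I), h⟩
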